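/- Let $\mathbb F$ be a field. A \emph{triassociative algebra} is an $\mathbb F$-vector space $L$ with three bilinear products $\vdash,\dashv,\perp$ satisfying, for all $x,y,z$, $(x\vdash y)\vdash z=(x\dashv y)\vdash z=(x\perp y)\vdash z=x\vdash(y\vdash z)$, $(x\dashv y)\dashv z=x\dashv(y\dashv z)=x\dashv(y\vdash z)=x\dashv(y\perp z)$, $(x\vdash y)\dashv z=x\vdash(y\dashv z)$, $(x\perp y)\dashv z=x\perp(y\dashv z)$, $(x\vdash y)\perp z=x\vdash(y\perp z)$, $(x\dashv y)\perp z=x\perp(y\vdash z)$, $(x\perp y)\perp z=x\perp(y\perp z)$. Its center $Z(L)$ is the ideal of all $z$ with $z*x=x*z=0$ for all $x\in L$ and $*\in\{\vdash,\dashv,\perp\}$, and $L'$ is the ideal spanned by all products $x*y$. A \emph{defining pair} for $L$ is a pair $(K,M)$ of a triassociative algebra $K$ and an ideal $M\subseteq Z(K)\cap K'$ with $K/M\cong L$; if $\dim K$ is maximal among all defining pairs, then $K$ is called a \emph{cover} of $L$ and $M=M(L)$ the \emph{multiplier} of $L$. \textbf{Theorem} (Ganea-type sequence). Let $L$ be a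 finite-dimensional triassociative algebra and $Z\subseteq Z(L)$ an ideal of $L$. Then $L$ and $L/Z$ have covers. Let $(K,M(L))$ and $(\bar K,M(L/Z))$ be any maximal defining pairs for $L$ and $L/Z$, with surjections $\lambda:K\to K/M(L)\cong L$ and $\bar\lambda:\bar K\to\bar K/M(L/Z)\cong L/Z$, and let $\pi:L\to L/Z$ be the projection. Then there is a homomorphism $h:K\to\bar K$ with $\bar\lambda h=\pi\lambda$, and there is an exact sequence of linear maps $$(L/L'\otimes Z\oplus Z\otimes L/L')^3\xrightarrow{\ \theta\ }M(L)\xrightarrow{\ \beta\ }M(L/Z)\xrightarrow{\ \gamma\ }L'\cap Z\to 0,$$ whose maps are the natural ones: (i) on the two summands that belong to the product $*\in\{\vdash,\dashv,\perp\}$, one has $\theta\big((\lambda(k)+L')\otimes\lambda(t)\big)=k*t$ and $\theta\big(\lambda(t)\otimes(\lambda(k)+L')\big)=t*k$ for all $k,t\in K$ with $\lambda(t)\in Z$; (ii) whenever $P$ is a triassociative algebra (for example the free algebra in a free presentation of $L$, or $K$ itself) and $\psi:P\to K$, $\varphi:P\to\bar K$ are homomorphisms with $\bar\lambda\varphi=\pi\lambda\psi$,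 one has, for $p\in P'$, $\beta(\psi(p))=\varphi(p)$ if $\psi(p)\in M(L)$, and $\gamma(\varphi(p))=\lambda(\psi(p))$ if $\varphi(p)\in M(L/Z)$. In particular $\beta$ is the restriction of $h$. -/

import Mathlib

open scoped TensorProduct

universe u v w

/-- Labels of the three products `⊢`, `⊣`, `⊥` of a triassociative algebra. -/
inductive TriOp where
  | vdash
  | dashv
  | perp
  deriving DecidableEq

open TriOp

/-- A triassociative algebra over the field `𝕜`: a vector space with three bilinear products
`⊢ = mul vdash`, `⊣ = mul dashv`, `⊥ = mul perp` subject to eleven relations. -/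
class TriassociativeAlgebra (𝕜 : Type v) (L : Type u) [Field 𝕜] [AddCommGroup L] [Module 𝕜 L] where
  /-- The three bilinear products. -/
  mul : TriOp → L →ₗ[𝕜] L →ₗ[𝕜] L
  vdash_vdash : ∀ x y z, mul vdash (mul vdash x y) z = mul vdash x (mul vdash y z)
  dashv_vdash : ∀ x y z, mul vdash (mul dashv x y) z = mul vdash x (mul vdash y z)
  perp_vdash : ∀ x y z, mul vdash (mul perp x y) z = mul vdash x (mul vdash y z)
  vdash_dashv : ∀ x y z, mul dashv (mul vdash x y) z = mul vdash x (mul dashv y z)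
  dashv_dashv : ∀ x y z, mul dashv (mul dashv x y) z = mul dashv x (mul dashv y z)
  dashv_dashv_vdash : ∀ x y z, mul dashv (mul dashv x y) z = mul dashv x (mul vdash y z)
  dashv_dashv_perp : ∀ x y z, mul dashv (mul dashv x y) z = mul dashv x (mul perp y z)
  perp_dashv : ∀ x y z, mul dashv (mul perp x y) z = mul perp x (mul dashv y z)
  vdash_perp : ∀ x y z, mul perp (mul vdash x y) z = mul vdash x (mul perp y z)
  dashv_perp : ∀ x y z, mul perp (mul dashv x y) z = mul perp x (mul vdash y z)
  perp_perp : ∀ x y z, mul perp (mul perp x y) z = mul perp x (mul perp y z)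

/-- The product of `x` and `y` with label `i`. -/
abbrev triMul (𝕜 : Type v) {L : Type u} [Field 𝕜] [AddCommGroup L] [Module 𝕜 L]
    [TriassociativeAlgebra 𝕜 L] (i : TriOp) (x y : L) : L :=
  TriassociativeAlgebra.mul (𝕜 := 𝕜) i x y

/-- Homomorphisms: linear maps that preserve the three products. -/
structure TriHom (𝕜 : Type v) (A : Type u) (B : Type w) [Field 𝕜]
    [AddCommGroup A] [Module 𝕜 A] [TriassociativeAlgebra 𝕜 A]
    [AddCommGroup B] [Module 𝕜 B] [TriassociativeAlgebra 𝕜 B] extends A →ₗ[𝕜] B where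
  map_triMul : ∀ (i : TriOp) (x y : A),
    toFun (triMul 𝕜 i x y) = triMul 𝕜 i (toFun x) (toFun y)

instance (𝕜 : Type v) (A : Type u) (B : Type w) [Field 𝕜]
    [AddCommGroup A] [Module 𝕜 A] [TriassociativeAlgebra 𝕜 A]
    [AddCommGroup B] [Module 𝕜 B] [TriassociativeAlgebra 𝕜 B] :
    CoeFun (TriHom 𝕜 A B) (fun _ => A → B) := ⟨fun f => f.toLinearMap⟩

/-- Two-sided ideals: subspaces that absorb all three products on both sides. -/
structure TriIdeal (𝕜 : Type v) (L : Type u) [Field 𝕜] [AddCommGroup L] [Module 𝕜 L]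
    [TriassociativeAlgebra 𝕜 L] extends Submodule 𝕜 L where
  mul_mem_left : ∀ (i : TriOp) (x : L) {y : L}, y ∈ carrier → triMul 𝕜 i x y ∈ carrier
  mul_mem_right : ∀ (i : TriOp) {x : L} (y : L), x ∈ carrier → triMul 𝕜 i x y ∈ carrier

section
variable (𝕜 : Type v) (L : Type u) [Field 𝕜] [AddCommGroup L] [Module 𝕜 L]
  [TriassociativeAlgebra 𝕜 L]

/-- The center `Z(L)`: all `z` with `z * x = x * z = 0` for every `x` and each product `*`. -/
def triCenter : TriIdeal 𝕜 L where
  carrier := {z | ∀ (i : TriOp) (x : L), triMul 𝕜 i z x = 0 ∧ triMul 𝕜 i x z = 0}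
  add_mem' := fun {a b} ha hb i x => by
    have h1 := ha i x
    have h2 := hb i x
    simp only [triMul] at h1 h2 ⊢
    simp [h1.1, h1.2, h2.1, h2.2]
  zero_mem' := fun i x => by simp [triMul]
  smul_mem' := fun c a ha i x => by
    have h1 := ha i x
    simp only [triMul] at h1 ⊢
    simp [h1.1, h1.2]
  mul_mem_left := fun i x y hy j t => by
    rw [(hy i x).2]; simp [triMul]
  mul_mem_right := fun i x y hx j t => by
    rw [(hx i y).1]; simp [triMul]

/-- The derived ideal `L' = L ⊢ L + L ⊣ L + L ⊥ L`. -/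
def triDerived : TriIdeal 𝕜 L where
  toSubmodule := Submodule.span 𝕜 {a : L | ∃ (i : TriOp) (x y : L), a = triMul 𝕜 i x y}
  mul_mem_left := fun i x {y} _ => Submodule.subset_span ⟨i, x, y, rfl⟩
  mul_mem_right := fun i {x} y _ => Submodule.subset_span ⟨i, x, y, rfl⟩

variable {𝕜 L}

/-- The product induced on the quotient by an ideal. -/
def TriIdeal.quotMul (I : TriIdeal 𝕜 L) (i : TriOp) :
    (L ⧸ I.toSubmodule) →ₗ[𝕜] (L ⧸ I.toSubmodule) →ₗ[𝕜] (L ⧸ I.toSubmodule) :=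
  I.toSubmodule.liftQ
    (LinearMap.flip (I.toSubmodule.liftQ
      (LinearMap.flip ((TriassociativeAlgebra.mul (𝕜 := 𝕜) (L := L) i).compr₂
        I.toSubmodule.mkQ))
      (fun y hy => by
        rw [LinearMap.mem_ker]
        ext x
        exact (Submodule.Quotient.mk_eq_zero _).2 (I.mul_mem_left i x hy))))
    (fun x hx => by
      rw [LinearMap.mem_ker]
      ext y
      exact (Submodule.Quotient.mk_eq_zero _).2 (I.mul_mem_right i y hx))

theorem TriIdeal.quotMul_mk (I : TriIdeal 𝕜 L) (i : TriOp) (x y : L) :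
    I.quotMul i (I.toSubmodule.mkQ x) (I.toSubmodule.mkQ y)
      = I.toSubmodule.mkQ (triMul 𝕜 i x y) := rfl

/-- The quotient algebra `L / I`, with `(x + I) * (y + I) = x * y + I`. -/
instance TriIdeal.quotientAlgebra (I : TriIdeal 𝕜 L) :
    TriassociativeAlgebra 𝕜 (L ⧸ I.toSubmodule) where
  mul := I.quotMul
  vdash_vdash := by
    rintro ⟨x⟩ ⟨y⟩ ⟨z⟩
    exact congrArg I.toSubmodule.mkQ (TriassociativeAlgebra.vdash_vdash x y z)
  dashv_vdash := by
    rintro ⟨x⟩ ⟨y⟩ ⟨z⟩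
    exact congrArg I.toSubmodule.mkQ (TriassociativeAlgebra.dashv_vdash x y z)
  perp_vdash := by
    rintro ⟨x⟩ ⟨y⟩ ⟨z⟩
    exact congrArg I.toSubmodule.mkQ (TriassociativeAlgebra.perp_vdash x y z)
  vdash_dashv := by
    rintro ⟨x⟩ ⟨y⟩ ⟨z⟩
    exact congrArg I.toSubmodule.mkQ (TriassociativeAlgebra.vdash_dashv x y z)
  dashv_dashv := by
    rintro ⟨x⟩ ⟨y⟩ ⟨z⟩
    exact congrArg I.toSubmodule.mkQ (TriassociativeAlgebra.dashv_dashv x y z)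
  dashv_dashv_vdash := by
    rintro ⟨x⟩ ⟨y⟩ ⟨z⟩
    exact congrArg I.toSubmodule.mkQ (TriassociativeAlgebra.dashv_dashv_vdash x y z)
  dashv_dashv_perp := by
    rintro ⟨x⟩ ⟨y⟩ ⟨z⟩
    exact congrArg I.toSubmodule.mkQ (TriassociativeAlgebra.dashv_dashv_perp x y z)
  perp_dashv := by
    rintro ⟨x⟩ ⟨y⟩ ⟨z⟩
    exact congrArg I.toSubmodule.mkQ (TriassociativeAlgebra.perp_dashv x y z)
  vdash_perp := by
    rintro ⟨x⟩ ⟨y⟩ ⟨z⟩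
    exact congrArg I.toSubmodule.mkQ (TriassociativeAlgebra.vdash_perp x y z)
  dashv_perp := by
    rintro ⟨x⟩ ⟨y⟩ ⟨z⟩
    exact congrArg I.toSubmodule.mkQ (TriassociativeAlgebra.dashv_perp x y z)
  perp_perp := by
    rintro ⟨x⟩ ⟨y⟩ ⟨z⟩
    exact congrArg I.toSubmodule.mkQ (TriassociativeAlgebra.perp_perp x y z)

/-- The natural projection `L → L / I`. -/
def TriIdeal.mkHom (I : TriIdeal 𝕜 L) : TriHom 𝕜 L (L ⧸ I.toSubmodule) where
  toLinearMap := I.toSubmodule.mkQ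
  map_triMul := fun _ _ _ => rfl

end

/-- A defining pair `(K, M)` for `L`, together with the isomorphism `K / M ≅ L`:
`M` is an ideal of `K` contained in `Z(K) ∩ K'`. -/
structure DefiningPair (𝕜 : Type v) (L : Type u) [Field 𝕜] [AddCommGroup L] [Module 𝕜 L]
    [TriassociativeAlgebra 𝕜 L] where
  /-- The first term `K`. -/
  K : Type u
  [addCommGroup : AddCommGroup K]
  [module : Module 𝕜 K]
  [algebra : TriassociativeAlgebra 𝕜 K]
  /-- The second term `M`. -/
  M : TriIdeal 𝕜 K
  /-- The isomorphism of `K / M` onto `L`. -/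
  iso : TriHom 𝕜 (K ⧸ M.toSubmodule) L
  bijective_iso : Function.Bijective iso
  le_center : M.toSubmodule ≤ (triCenter 𝕜 K).toSubmodule
  le_derived : M.toSubmodule ≤ (triDerived 𝕜 K).toSubmodule

attribute [instance] DefiningPair.addCommGroup DefiningPair.module DefiningPair.algebra

namespace DefiningPair

variable {𝕜 : Type v} {L : Type u} [Field 𝕜] [AddCommGroup L] [Module 𝕜 L]
  [TriassociativeAlgebra 𝕜 L]

/-- The surjection `K → K / M ≅ L`, with kernel `M`. -/
def proj (D : DefiningPair 𝕜 L) : TriHom 𝕜 D.K L where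
  toLinearMap := D.iso.toLinearMap ∘ₗ D.M.toSubmodule.mkQ
  map_triMul := fun i x y => D.iso.map_triMul i (D.M.mkHom x) (D.M.mkHom y)

/-- The pair is maximal: `dim K` is largest among all defining pairs for `L`. Then `K` is a cover
of `L` and `M` is the multiplier `M(L)`. -/
def IsMaximal (D : DefiningPair 𝕜 L) : Prop :=
  ∀ D₂ : DefiningPair 𝕜 L, Module.rank 𝕜 D₂.K ≤ Module.rank 𝕜 D.K

/-- The multiplier of `L`, as a vector space, when the pair is maximal. -/
abbrev multiplier (D : DefiningPair 𝕜 L) : Submodule 𝕜 D.K := D.M.toSubmodule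

end DefiningPair

section
variable {𝕜 : Type v} {L : Type u} [Field 𝕜] [AddCommGroup L] [Module 𝕜 L]
  [TriassociativeAlgebra 𝕜 L]

/-- The space `(L/L' ⊗ Z ⊕ Z ⊗ L/L')³`, one summand for each of the three products. -/
abbrev GaneaTensor (Z : TriIdeal 𝕜 L) : Type u :=
  TriOp → ((L ⧸ (triDerived 𝕜 L).toSubmodule) ⊗[𝕜] Z.toSubmodule) ×
    (Z.toSubmodule ⊗[𝕜] (L ⧸ (triDerived 𝕜 L).toSubmodule))

/-- `θ` multiplies lifts: on the summand of the product `*`, it maps `(x + L') ⊗ z` to `k * t` and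
`z ⊗ (x + L')` to `t * k`, for all `k, t` in the cover that lie over `x` and `z`. -/
def IsGaneaMap (Z : TriIdeal 𝕜 L) (D : DefiningPair 𝕜 L)
    (θ : GaneaTensor Z →ₗ[𝕜] D.multiplier) : Prop :=
  ∀ (i : TriOp) (k t : D.K) (ht : D.proj t ∈ Z.toSubmodule),
    (θ (Pi.single i
      ((triDerived 𝕜 L).toSubmodule.mkQ (D.proj k) ⊗ₜ[𝕜] (⟨D.proj t, ht⟩ : Z.toSubmodule), 0))
        : D.K) = triMul 𝕜 i k t ∧
    (θ (Pi.single i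
      (0, (⟨D.proj t, ht⟩ : Z.toSubmodule) ⊗ₜ[𝕜] (triDerived 𝕜 L).toSubmodule.mkQ (D.proj k)))
        : D.K) = triMul 𝕜 i t k

/-- `ψ : P → K` and `φ : P → K₂` are lifts, to the covers of `L` and `L / Z`, of one homomorphism
`P → L` and of its composite with `L → L / Z`. A typical `P` is the free algebra of a
presentation of `L`. -/
def AreLifts (Z : TriIdeal 𝕜 L) (D : DefiningPair 𝕜 L) (D₂ : DefiningPair 𝕜 (L ⧸ Z.toSubmodule))
    {P : Type w} [AddCommGroup P] [Module 𝕜 P] [TriassociativeAlgebra 𝕜 P]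
    (ψ : TriHom 𝕜 P D.K) (φ : TriHom 𝕜 P D₂.K) : Prop :=
  ∀ p : P, D₂.proj (φ p) = Z.mkHom (D.proj (ψ p))

end

/-! Everything rests on one property of a cover `K` of `L` with multiplier `M`. Products in any
algebra depend only on classes modulo the center. So homomorphisms that agree modulo the center
agree on the derived ideal, and a map that is onto modulo the center is onto on derived ideals.

Let `p : Q → K` be a surjection for which the preimage `U` of `M` is central in `Q`. Dividing `Q` by
a complement of `Q' ∩ U` in `U` gives a defining pair for `L` with second term isomorphic to `Q' ∩
U`. Maximality of `K` bounds its dimension by `dim M`, while `p` maps `Q' ∩ U` onto `M`; hence `p`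
is injective on `Q'` (`eq_zero_of_mem_derived`). A complement of `ker p` containing `Q'` is then a
subalgebra, so `p` splits (`exists_section`). Pulling back along a given map shows that covers lift
through every central extension (`exists_lift`); this replaces free presentations.

For the sequence, let `J` be the span in `K` of all products with elements over `Z`. It is the image
of `θ`. Lifting gives `h : K → K̄` over `L → L/Z`, and also `g : K̄ → K/J` over `L/Z`, because `K/J`
is a central extension of `L/Z`. On `K'` the composite `g ∘ h` is the quotient map, so `ker h ∩ K' =
J`. Take `β` to be `h`, and `γ` to be `g` followed by `K/J → L`. Exactness follows from `J ⊆ M ⊆ K'`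
and the surjectivity of `h` on derived ideals. -/

/-! ### Homomorphisms, ideals, the center and the derived ideal. -/

section Basic

variable {𝕜 : Type v} [Field 𝕜]
variable {A : Type*} [AddCommGroup A] [Module 𝕜 A] [TriassociativeAlgebra 𝕜 A]
variable {B : Type*} [AddCommGroup B] [Module 𝕜 B] [TriassociativeAlgebra 𝕜 B]
variable {C : Type*} [AddCommGroup C] [Module 𝕜 C] [TriassociativeAlgebra 𝕜 C]

theorem TriHom.map_mul (f : TriHom 𝕜 A B) (i : TriOp) (x y : A) :
    f (triMul 𝕜 i x y) = triMul 𝕜 i (f x) (f y) :=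
  f.map_triMul i x y

/-- Composition of homomorphisms. -/
def TriHom.comp (g : TriHom 𝕜 B C) (f : TriHom 𝕜 A B) : TriHom 𝕜 A C where
  toLinearMap := g.toLinearMap ∘ₗ f.toLinearMap
  map_triMul i x y := (congrArg g (f.map_mul i x y)).trans (g.map_mul i _ _)

/-- The identity homomorphism. -/
def TriHom.id (𝕜 : Type v) [Field 𝕜] (A : Type*) [AddCommGroup A] [Module 𝕜 A]
    [TriassociativeAlgebra 𝕜 A] : TriHom 𝕜 A A where
  toLinearMap := LinearMap.id
  map_triMul _ _ _ := rfl

/-- The kernel of a homomorphism, as an ideal. -/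
def TriHom.ker (f : TriHom 𝕜 A B) : TriIdeal 𝕜 A where
  toSubmodule := LinearMap.ker f.toLinearMap
  mul_mem_left i x {y} hy := by
    have hy : f y = 0 := hy
    change f (triMul 𝕜 i x y) = 0
    rw [f.map_mul, hy, triMul, map_zero]
  mul_mem_right i {x} y hx := by
    have hx : f x = 0 := hx
    change f (triMul 𝕜 i x y) = 0
    rw [f.map_mul, hx, triMul, map_zero, LinearMap.zero_apply]

/-- The homomorphism induced on a quotient by an ideal on which the given one vanishes. -/
def TriIdeal.lift (I : TriIdeal 𝕜 A) (f : TriHom 𝕜 A B) (h : ∀ x ∈ I.toSubmodule, f x = 0) :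
    TriHom 𝕜 (A ⧸ I.toSubmodule) B where
  toLinearMap := I.toSubmodule.liftQ f.toLinearMap h
  map_triMul i := by
    rintro ⟨x⟩ ⟨y⟩
    exact f.map_mul i x y

/-- A subspace of the center is an ideal. -/
def TriIdeal.ofLECenter (S : Submodule 𝕜 A) (h : S ≤ (triCenter 𝕜 A).toSubmodule) :
    TriIdeal 𝕜 A where
  toSubmodule := S
  mul_mem_left i x {y} hy := by
    have : triMul 𝕜 i x y = 0 := (h hy i x).2
    rw [this]
    exact S.zero_mem
  mul_mem_right i {x} y hx := by
    have : triMul 𝕜 i x y = 0 := (h hx i y).1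
    rw [this]
    exact S.zero_mem

/-- Write `a * b - a' * b' = (a - a') * b + a' * (b - b')`; both terms vanish. This is the source of
every independence-of-lifts argument below. -/
theorem triMul_eq_of_sub_mem_center (i : TriOp) {a a' b b' : A}
    (ha : a - a' ∈ (triCenter 𝕜 A).toSubmodule) (hb : b - b' ∈ (triCenter 𝕜 A).toSubmodule) :
    triMul 𝕜 i a b = triMul 𝕜 i a' b' := by
  have h1 := (ha i b).1
  have h2 := (hb i a').2
  simp only [triMul, map_sub, LinearMap.sub_apply, sub_eq_zero] at h1 h2 ⊢
  exact h1.trans h2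

theorem triMul_mem_derived (i : TriOp) (x y : A) :
    triMul 𝕜 i x y ∈ (triDerived 𝕜 A).toSubmodule :=
  Submodule.subset_span ⟨i, x, y, rfl⟩

theorem triDerived_le {S : Submodule 𝕜 A} (h : ∀ i x y, triMul 𝕜 i x y ∈ S) :
    (triDerived 𝕜 A).toSubmodule ≤ S :=
  Submodule.span_le.2 (by rintro _ ⟨i, x, y, rfl⟩; exact h i x y)

theorem TriHom.map_mem_derived (f : TriHom 𝕜 A B) {x : A}
    (hx : x ∈ (triDerived 𝕜 A).toSubmodule) : f x ∈ (triDerived 𝕜 B).toSubmodule :=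
  triDerived_le (S := (triDerived 𝕜 B).toSubmodule.comap f.toLinearMap)
    (fun i x y => by
      change f (triMul 𝕜 i x y) ∈ (triDerived 𝕜 B).toSubmodule
      rw [f.map_mul]
      exact triMul_mem_derived i _ _) hx

/-- Homomorphisms that agree modulo the center agree on the derived ideal. -/
theorem TriHom.eqOn_derived (f g : TriHom 𝕜 A B)
    (h : ∀ x, f x - g x ∈ (triCenter 𝕜 B).toSubmodule) {x : A}
    (hx : x ∈ (triDerived 𝕜 A).toSubmodule) : f x = g x :=
  triDerived_le (S := LinearMap.eqLocus f.toLinearMap g.toLinearMap)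
    (fun i x y => by
      change f (triMul 𝕜 i x y) = g (triMul 𝕜 i x y)
      rw [f.map_mul, g.map_mul]
      exact triMul_eq_of_sub_mem_center i (h x) (h y)) hx

/-- A homomorphism that is surjective modulo the center is surjective on derived ideals. -/
theorem TriHom.exists_mem_derived (f : TriHom 𝕜 A B)
    (h : ∀ y, ∃ x, y - f x ∈ (triCenter 𝕜 B).toSubmodule) {y : B}
    (hy : y ∈ (triDerived 𝕜 B).toSubmodule) : ∃ x ∈ (triDerived 𝕜 A).toSubmodule, f x = y :=
  triDerived_le (S := (triDerived 𝕜 A).toSubmodule.map f.toLinearMap)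
    (fun i x y => by
      obtain ⟨a, ha⟩ := h x
      obtain ⟨b, hb⟩ := h y
      refine ⟨triMul 𝕜 i a b, triMul_mem_derived i a b, ?_⟩
      rw [triMul_eq_of_sub_mem_center i ha hb]
      exact f.map_mul i a b) hy

theorem TriHom.exists_mem_derived_of_surjective (f : TriHom 𝕜 A B) (h : Function.Surjective f)
    {y : B} (hy : y ∈ (triDerived 𝕜 B).toSubmodule) :
    ∃ x ∈ (triDerived 𝕜 A).toSubmodule, f x = y :=
  f.exists_mem_derived (fun y => by
    obtain ⟨x, rfl⟩ := h y
    exact ⟨x, by rw [sub_self]; exact Submodule.zero_mem _⟩) hy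

theorem TriHom.exists_linear_section (f : TriHom 𝕜 A B) (h : Function.Surjective f) :
    ∃ s : B →ₗ[𝕜] A, ∀ y, f (s y) = y := by
  obtain ⟨s, hs⟩ := f.toLinearMap.exists_rightInverse_of_surjective (LinearMap.range_eq_top.2 h)
  exact ⟨s, fun y => LinearMap.congr_fun hs y⟩

/-- Among the eleven relations, each of the nine label pairs occurs as a left bracketing. Only the
existence of the new labels matters later. -/
theorem exists_triMul_triMul_eq_left (i j : TriOp) : ∃ k l : TriOp, ∀ x y z : A,
    triMul 𝕜 j (triMul 𝕜 i x y) z = triMul 𝕜 k x (triMul 𝕜 l y z) := by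
  cases i <;> cases j
  exacts [⟨_, _, TriassociativeAlgebra.vdash_vdash⟩, ⟨_, _, TriassociativeAlgebra.vdash_dashv⟩,
    ⟨_, _, TriassociativeAlgebra.vdash_perp⟩, ⟨_, _, TriassociativeAlgebra.dashv_vdash⟩,
    ⟨_, _, TriassociativeAlgebra.dashv_dashv⟩, ⟨_, _, TriassociativeAlgebra.dashv_perp⟩,
    ⟨_, _, TriassociativeAlgebra.perp_vdash⟩, ⟨_, _, TriassociativeAlgebra.perp_dashv⟩,
    ⟨_, _, TriassociativeAlgebra.perp_perp⟩]

/-- Each of the nine label pairs also occurs as a right bracketing in some relation. -/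
theorem exists_triMul_triMul_eq_right (k l : TriOp) : ∃ i j : TriOp, ∀ x y z : A,
    triMul 𝕜 k x (triMul 𝕜 l y z) = triMul 𝕜 j (triMul 𝕜 i x y) z := by
  cases k <;> cases l
  exacts [⟨_, _, fun x y z => (TriassociativeAlgebra.vdash_vdash x y z).symm⟩,
    ⟨_, _, fun x y z => (TriassociativeAlgebra.vdash_dashv x y z).symm⟩,
    ⟨_, _, fun x y z => (TriassociativeAlgebra.vdash_perp x y z).symm⟩,
    ⟨_, _, fun x y z => (TriassociativeAlgebra.dashv_dashv_vdash x y z).symm⟩,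
    ⟨_, _, fun x y z => (TriassociativeAlgebra.dashv_dashv x y z).symm⟩,
    ⟨_, _, fun x y z => (TriassociativeAlgebra.dashv_dashv_perp x y z).symm⟩,
    ⟨_, _, fun x y z => (TriassociativeAlgebra.dashv_perp x y z).symm⟩,
    ⟨_, _, fun x y z => (TriassociativeAlgebra.perp_dashv x y z).symm⟩,
    ⟨_, _, fun x y z => (TriassociativeAlgebra.perp_perp x y z).symm⟩]

/-- If all products of `t` are central, then `t` annihilates the derived ideal. -/
theorem triMul_derived_eq_zero {t : A}
    (ht : ∀ i x, triMul 𝕜 i x t ∈ (triCenter 𝕜 A).toSubmodule ∧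
      triMul 𝕜 i t x ∈ (triCenter 𝕜 A).toSubmodule)
    (j : TriOp) {a : A} (ha : a ∈ (triDerived 𝕜 A).toSubmodule) :
    triMul 𝕜 j a t = 0 ∧ triMul 𝕜 j t a = 0 := by
  constructor
  · refine triDerived_le (S := LinearMap.ker
      ((TriassociativeAlgebra.mul (𝕜 := 𝕜) (L := A) j).flip t)) (fun i x y => ?_) ha
    change triMul 𝕜 j (triMul 𝕜 i x y) t = 0
    -- Rebracketing moves `t` into the inner product, which is central by assumption, so the outer
    -- product is zero.
    obtain ⟨k, l, h⟩ := exists_triMul_triMul_eq_left (𝕜 := 𝕜) (A := A) i j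
    rw [h]
    exact ((ht l y).1 k x).2
  · refine triDerived_le (S := LinearMap.ker
      (TriassociativeAlgebra.mul (𝕜 := 𝕜) (L := A) j t)) (fun i x y => ?_) ha
    change triMul 𝕜 j t (triMul 𝕜 i x y) = 0
    obtain ⟨k, l, h⟩ := exists_triMul_triMul_eq_right (𝕜 := 𝕜) (A := A) j i
    rw [h]
    exact ((ht k x).2 l y).1

end Basic

/-! ### Fiber products of triassociative algebras. -/

section Pullback

variable {𝕜 : Type v} [Field 𝕜]
variable {A : Type*} [AddCommGroup A] [Module 𝕜 A] [TriassociativeAlgebra 𝕜 A]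
variable {B : Type*} [AddCommGroup B] [Module 𝕜 B] [TriassociativeAlgebra 𝕜 B]
variable {C : Type*} [AddCommGroup C] [Module 𝕜 C] [TriassociativeAlgebra 𝕜 C]

/-- The fiber product of two homomorphisms with the same target. -/
abbrev TriHom.pullback (f : TriHom 𝕜 A C) (g : TriHom 𝕜 B C) : Submodule 𝕜 (A × B) :=
  LinearMap.eqLocus (f.toLinearMap ∘ₗ LinearMap.fst 𝕜 A B)
    (g.toLinearMap ∘ₗ LinearMap.snd 𝕜 A B)

instance TriHom.pullbackAlgebra (f : TriHom 𝕜 A C) (g : TriHom 𝕜 B C) :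
    TriassociativeAlgebra 𝕜 (f.pullback g) where
  mul i := LinearMap.mk₂ 𝕜
    (fun x y => ⟨(triMul 𝕜 i x.1.1 y.1.1, triMul 𝕜 i x.1.2 y.1.2), by
      change f (triMul 𝕜 i x.1.1 y.1.1) = g (triMul 𝕜 i x.1.2 y.1.2)
      have hx : f x.1.1 = g x.1.2 := x.2
      have hy : f y.1.1 = g y.1.2 := y.2
      rw [f.map_mul, g.map_mul, hx, hy]⟩)
    (fun x y z => Subtype.ext (Prod.ext (by simp [triMul]) (by simp [triMul])))
    (fun c x y => Subtype.ext (Prod.ext (by simp [triMul]) (by simp [triMul])))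
    (fun x y z => Subtype.ext (Prod.ext (by simp [triMul]) (by simp [triMul])))
    (fun c x y => Subtype.ext (Prod.ext (by simp [triMul]) (by simp [triMul])))
  vdash_vdash _ _ _ := Subtype.ext (Prod.ext
    (TriassociativeAlgebra.vdash_vdash _ _ _) (TriassociativeAlgebra.vdash_vdash _ _ _))
  dashv_vdash _ _ _ := Subtype.ext (Prod.ext
    (TriassociativeAlgebra.dashv_vdash _ _ _) (TriassociativeAlgebra.dashv_vdash _ _ _))
  perp_vdash _ _ _ := Subtype.ext (Prod.ext
    (TriassociativeAlgebra.perp_vdash _ _ _) (TriassociativeAlgebra.perp_vdash _ _ _))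
  vdash_dashv _ _ _ := Subtype.ext (Prod.ext
    (TriassociativeAlgebra.vdash_dashv _ _ _) (TriassociativeAlgebra.vdash_dashv _ _ _))
  dashv_dashv _ _ _ := Subtype.ext (Prod.ext
    (TriassociativeAlgebra.dashv_dashv _ _ _) (TriassociativeAlgebra.dashv_dashv _ _ _))
  dashv_dashv_vdash _ _ _ := Subtype.ext (Prod.ext
    (TriassociativeAlgebra.dashv_dashv_vdash _ _ _)
    (TriassociativeAlgebra.dashv_dashv_vdash _ _ _))
  dashv_dashv_perp _ _ _ := Subtype.ext (Prod.ext
    (TriassociativeAlgebra.dashv_dashv_perp _ _ _)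
    (TriassociativeAlgebra.dashv_dashv_perp _ _ _))
  perp_dashv _ _ _ := Subtype.ext (Prod.ext
    (TriassociativeAlgebra.perp_dashv _ _ _) (TriassociativeAlgebra.perp_dashv _ _ _))
  vdash_perp _ _ _ := Subtype.ext (Prod.ext
    (TriassociativeAlgebra.vdash_perp _ _ _) (TriassociativeAlgebra.vdash_perp _ _ _))
  dashv_perp _ _ _ := Subtype.ext (Prod.ext
    (TriassociativeAlgebra.dashv_perp _ _ _) (TriassociativeAlgebra.dashv_perp _ _ _))
  perp_perp _ _ _ := Subtype.ext (Prod.ext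
    (TriassociativeAlgebra.perp_perp _ _ _) (TriassociativeAlgebra.perp_perp _ _ _))

/-- The first projection of the fiber product. -/
def TriHom.pullbackFst (f : TriHom 𝕜 A C) (g : TriHom 𝕜 B C) : TriHom 𝕜 (f.pullback g) A where
  toLinearMap := LinearMap.fst 𝕜 A B ∘ₗ (f.pullback g).subtype
  map_triMul _ _ _ := rfl

/-- The second projection of the fiber product. -/
def TriHom.pullbackSnd (f : TriHom 𝕜 A C) (g : TriHom 𝕜 B C) : TriHom 𝕜 (f.pullback g) B where
  toLinearMap := LinearMap.snd 𝕜 A B ∘ₗ (f.pullback g).subtype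
  map_triMul _ _ _ := rfl

end Pullback

/-! ### Defining pairs: dimension bounds and existence of covers. -/

namespace DefiningPair

variable {𝕜 : Type v} {L : Type u} [Field 𝕜] [AddCommGroup L] [Module 𝕜 L]
  [TriassociativeAlgebra 𝕜 L]

/-- The defining pair given by a surjection whose kernel is contained in `Z(K) ∩ K'`. -/
def ofSurjective {K : Type u} [AddCommGroup K] [Module 𝕜 K] [TriassociativeAlgebra 𝕜 K]
    (f : TriHom 𝕜 K L) (hf : Function.Surjective f)
    (hc : ∀ x, f x = 0 → x ∈ (triCenter 𝕜 K).toSubmodule)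
    (hd : ∀ x, f x = 0 → x ∈ (triDerived 𝕜 K).toSubmodule) : DefiningPair 𝕜 L where
  K := K
  M := f.ker
  iso := f.ker.lift f (fun _ hx => hx)
  bijective_iso := (f.toLinearMap.quotKerEquivOfSurjective hf).bijective
  le_center := hc
  le_derived := hd

theorem proj_surjective (D : DefiningPair 𝕜 L) : Function.Surjective D.proj :=
  D.bijective_iso.2.comp (Submodule.mkQ_surjective _)

theorem proj_eq_zero_iff (D : DefiningPair 𝕜 L) {k : D.K} :
    D.proj k = 0 ↔ k ∈ D.M.toSubmodule := by
  refine ⟨fun h => ?_, fun h => ?_⟩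
  · refine (Submodule.Quotient.mk_eq_zero _).1 (D.bijective_iso.1 ?_)
    exact h.trans (map_zero D.iso.toLinearMap).symm
  · refine Eq.trans (congrArg D.iso ((Submodule.Quotient.mk_eq_zero _).2 h)) ?_
    exact map_zero D.iso.toLinearMap

theorem sub_mem_center (D : DefiningPair 𝕜 L) {x y : D.K} (h : D.proj x = D.proj y) :
    x - y ∈ (triCenter 𝕜 D.K).toSubmodule :=
  D.le_center (D.proj_eq_zero_iff.1 ((map_sub D.proj.toLinearMap x y).trans (sub_eq_zero.2 h)))

theorem rank_eq (D : DefiningPair 𝕜 L) :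
    Module.rank 𝕜 D.K = Module.rank 𝕜 L + Module.rank 𝕜 D.M.toSubmodule := by
  have hk : LinearMap.ker D.proj.toLinearMap = D.M.toSubmodule :=
    Submodule.ext fun _ => D.proj_eq_zero_iff
  rw [← LinearMap.rank_range_add_rank_ker D.proj.toLinearMap, hk,
    LinearMap.range_eq_top.2 D.proj_surjective, rank_top]

/-- Since `M` is central, each product of `K` factors through `K/M ≅ L`, so `K'` is the image of
three copies of `L ⊗ L`; and `M ⊆ K'`. -/
theorem rank_M_le (D : DefiningPair 𝕜 L) :
    Module.rank 𝕜 D.M.toSubmodule ≤ Module.rank 𝕜 ((L ⊗[𝕜] L) × (L ⊗[𝕜] L) × (L ⊗[𝕜] L)) := by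
  obtain ⟨s, hs⟩ := D.proj.exists_linear_section D.proj_surjective
  let m (i : TriOp) : L ⊗[𝕜] L →ₗ[𝕜] D.K :=
    TensorProduct.lift ((TriassociativeAlgebra.mul (𝕜 := 𝕜) (L := D.K) i).compl₁₂ s s)
  let F := (m vdash).coprod ((m dashv).coprod (m perp))
  have hm (i : TriOp) (x y : D.K) : m i (D.proj x ⊗ₜ D.proj y) = triMul 𝕜 i x y :=
    triMul_eq_of_sub_mem_center i (D.sub_mem_center (hs _)) (D.sub_mem_center (hs _))
  have hF : D.M.toSubmodule ≤ LinearMap.range F := by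
    refine D.le_derived.trans (triDerived_le fun i x y => ?_)
    cases i
    · exact ⟨(D.proj x ⊗ₜ D.proj y, 0, 0), by simp [F, hm]⟩
    · exact ⟨(0, D.proj x ⊗ₜ D.proj y, 0), by simp [F, hm]⟩
    · exact ⟨(0, 0, D.proj x ⊗ₜ D.proj y), by simp [F, hm]⟩
  exact (Submodule.rank_mono hF).trans (rank_range_le F)

theorem rank_le (D : DefiningPair 𝕜 L) : Module.rank 𝕜 D.K ≤
    Module.rank 𝕜 (L × (L ⊗[𝕜] L) × (L ⊗[𝕜] L) × (L ⊗[𝕜] L)) := by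
  rw [D.rank_eq, rank_prod' (M := L)]
  gcongr
  exact D.rank_M_le

instance finite_K [FiniteDimensional 𝕜 L] (D : DefiningPair 𝕜 L) : Module.Finite 𝕜 D.K :=
  Module.rank_lt_aleph0_iff.1 (D.rank_le.trans_lt (Module.rank_lt_aleph0 𝕜 _))

/-- The dimensions of first terms form a nonempty bounded set of naturals, so their supremum is
attained. -/
theorem exists_isMaximal (𝕜 : Type v) (L : Type u) [Field 𝕜] [AddCommGroup L] [Module 𝕜 L]
    [TriassociativeAlgebra 𝕜 L] [FiniteDimensional 𝕜 L] :
    ∃ D : DefiningPair 𝕜 L, D.IsMaximal := by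
  let S : Set ℕ := Set.range fun D : DefiningPair 𝕜 L => Module.finrank 𝕜 D.K
  -- The trivial pair `(L, 0)`.
  have hne : S.Nonempty := ⟨_, ofSurjective (TriHom.id 𝕜 L) Function.surjective_id
    (fun x hx => by
      have hx : x = 0 := hx
      rw [hx]; exact Submodule.zero_mem _)
    (fun x hx => by
      have hx : x = 0 := hx
      rw [hx]; exact Submodule.zero_mem _), rfl⟩
  have hb : BddAbove S := by
    refine ⟨Module.finrank 𝕜 (L × (L ⊗[𝕜] L) × (L ⊗[𝕜] L) × (L ⊗[𝕜] L)), ?_⟩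
    rintro _ ⟨D, rfl⟩
    exact Module.finrank_le_finrank_of_rank_le_rank (by simpa using D.rank_le)
      (Module.rank_lt_aleph0 𝕜 _)
  obtain ⟨D, hD⟩ := Nat.sSup_mem hne hb
  refine ⟨D, fun D₂ => ?_⟩
  rw [← Module.finrank_eq_rank 𝕜 D.K, ← Module.finrank_eq_rank 𝕜 D₂.K, Nat.cast_le]
  exact (le_csSup hb ⟨D₂, rfl⟩).trans_eq hD.symm

/-! ### Splitting and lifting properties of covers. -/

/-- A surjection onto a cover which is central over `L` is injective on the derived ideal. -/
theorem IsMaximal.eq_zero_of_mem_derived [FiniteDimensional 𝕜 L] {D : DefiningPair 𝕜 L}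
    (hD : D.IsMaximal) {Q : Type u} [AddCommGroup Q] [Module 𝕜 Q] [TriassociativeAlgebra 𝕜 Q]
    (p : TriHom 𝕜 Q D.K) (hp : Function.Surjective p)
    (hc : ∀ q, D.proj (p q) = 0 → q ∈ (triCenter 𝕜 Q).toSubmodule)
    {q : Q} (hq : q ∈ (triDerived 𝕜 Q).toSubmodule) (h0 : p q = 0) : q = 0 := by
  let f := D.proj.comp p
  let U := LinearMap.ker f.toLinearMap
  let N := (triDerived 𝕜 Q).toSubmodule ⊓ U
  -- Dividing out a complement `S` of `N` in `U` removes exactly the part of the kernel that `Q'`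
  -- does not reach. It is an ideal because `U` is central.
  obtain ⟨S, hNS, hsup⟩ := IsModularLattice.exists_disjoint_and_sup_eq
    (inf_le_right : N ≤ U)
  have hSU : S ≤ U := hsup ▸ le_sup_right
  let I : TriIdeal 𝕜 Q := TriIdeal.ofLECenter S (hSU.trans hc)
  have hmk (y : Q ⧸ I.toSubmodule) : ∃ x, I.mkHom x = y := S.mkQ_surjective y
  let g : TriHom 𝕜 (Q ⧸ I.toSubmodule) L := I.lift f hSU
  have hg (x : Q) : g (I.mkHom x) = f x := rfl
  let E : DefiningPair 𝕜 L := ofSurjective g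
    (fun y => by
      obtain ⟨x, hx⟩ := (D.proj_surjective.comp hp) y
      exact ⟨I.mkHom x, hx⟩)
    (fun y hy i z => by
      obtain ⟨y, rfl⟩ := hmk y
      obtain ⟨z, rfl⟩ := hmk z
      rw [← I.mkHom.map_mul, ← I.mkHom.map_mul, (hc y hy i z).1, (hc y hy i z).2]
      exact ⟨map_zero I.mkHom.toLinearMap, map_zero I.mkHom.toLinearMap⟩)
    (fun y hy => by
      obtain ⟨y, rfl⟩ := hmk y
      have hy : y ∈ U := hy
      -- Modulo `S` every element of `U = N + S` has a representative in `N`, hence in the derived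
      -- ideal.
      rw [← hsup] at hy
      obtain ⟨n, hn, t, ht, rfl⟩ := Submodule.mem_sup.1 hy
      have h : I.mkHom (n + t) = I.mkHom n :=
        (Submodule.Quotient.eq S).2 (by simpa using ht)
      rw [h]
      exact I.mkHom.map_mem_derived hn.1)
  let j : N →ₗ[𝕜] E.M.toSubmodule :=
    (S.mkQ ∘ₗ N.subtype).codRestrict E.M.toSubmodule (fun n => n.2.2)
  have hj : Function.Injective j := by
    rw [injective_iff_map_eq_zero]
    intro n hn
    have h : (n : Q) ∈ S := (Submodule.Quotient.mk_eq_zero S).1 (congrArg Subtype.val hn)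
    exact Subtype.ext ((Submodule.disjoint_def.1 hNS) _ n.2 h)
  -- `Q` itself may be infinite-dimensional; finiteness of `N` comes from its embedding into the
  -- second term of the new pair.
  have : Module.Finite 𝕜 N := Module.Finite.of_injective j hj
  have hNM : Module.finrank 𝕜 N ≤ Module.finrank 𝕜 D.M.toSubmodule := by
    refine (LinearMap.finrank_le_finrank_of_injective hj).trans ?_
    -- Both first terms have dimension `dim L` plus that of the second term, so maximality compares
    -- the second terms.
    have h := hD E
    rw [E.rank_eq, D.rank_eq] at h
    simp only [← Module.finrank_eq_rank] at h
    norm_cast at h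
    omega
  let r : N →ₗ[𝕜] D.M.toSubmodule :=
    (p.toLinearMap ∘ₗ N.subtype).codRestrict D.M.toSubmodule
      (fun n => D.proj_eq_zero_iff.1 n.2.2)
  have hr : Function.Surjective r := by
    intro m
    obtain ⟨x, hx, hxm⟩ := p.exists_mem_derived_of_surjective hp (D.le_derived m.2)
    refine ⟨⟨x, hx, ?_⟩, Subtype.ext hxm⟩
    change D.proj (p x) = 0
    rw [hxm]
    exact D.proj_eq_zero_iff.2 m.2
  -- The two inequalities make the dimensions equal, so the surjection `N → M` is injective.
  have hinj : Function.Injective r :=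
    (LinearMap.injective_iff_surjective_of_finrank_eq_finrank
      (hNM.antisymm (LinearMap.finrank_le_finrank_of_surjective hr))).2 hr
  have hqU : q ∈ U := by
    change D.proj (p q) = 0
    rw [h0]
    exact map_zero D.proj.toLinearMap
  have h : (⟨q, hq, hqU⟩ : N) = 0 :=
    (injective_iff_map_eq_zero r).1 hinj _ (Subtype.ext h0)
  exact congrArg Subtype.val h

/-- A surjection onto a cover which is central over `L` splits. -/
theorem IsMaximal.exists_section [FiniteDimensional 𝕜 L] {D : DefiningPair 𝕜 L}
    (hD : D.IsMaximal) {Q : Type u} [AddCommGroup Q] [Module 𝕜 Q] [TriassociativeAlgebra 𝕜 Q]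
    (p : TriHom 𝕜 Q D.K) (hp : Function.Surjective p)
    (hc : ∀ q, D.proj (p q) = 0 → q ∈ (triCenter 𝕜 Q).toSubmodule) :
    ∃ r : TriHom 𝕜 D.K Q, ∀ k, p (r k) = k := by
  have hdisj : Disjoint (triDerived 𝕜 Q).toSubmodule (LinearMap.ker p.toLinearMap) :=
    Submodule.disjoint_def.2 fun q hq h0 => hD.eq_zero_of_mem_derived p hp hc hq h0
  -- Any subspace containing `Q'` is closed under products, so this linear complement is
  -- automatically a subalgebra and `p` maps it isomorphically onto `K`.
  obtain ⟨W, hW, hcompl⟩ := hdisj.exists_isCompl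
  have hinj {x y : Q} (hx : x ∈ W) (hy : y ∈ W) (h : p x = p y) : x = y :=
    sub_eq_zero.1 (Submodule.disjoint_def.1 hcompl.disjoint _ (W.sub_mem hx hy)
      ((map_sub p.toLinearMap x y).trans (sub_eq_zero.2 h)))
  let e : W ≃ₗ[𝕜] D.K := LinearEquiv.ofBijective (p.toLinearMap ∘ₗ W.subtype)
    ⟨fun x y h => Subtype.ext (hinj x.2 y.2 h), fun k => by
      obtain ⟨q, rfl⟩ := hp k
      obtain ⟨w, hw, a, ha, rfl⟩ :=
        Submodule.mem_sup.1 (hcompl.sup_eq_top ▸ Submodule.mem_top : q ∈ W ⊔ _)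
      have ha : p a = 0 := ha
      refine ⟨⟨w, hw⟩, ?_⟩
      change p w = p (w + a)
      rw [map_add, ha, add_zero]⟩
  have he (k : D.K) : p (e.symm k : Q) = k := e.apply_symm_apply k
  refine ⟨⟨W.subtype ∘ₗ e.symm.toLinearMap, fun i x y => ?_⟩, he⟩
  refine hinj (e.symm _).2 (hW (triMul_mem_derived i _ _)) ((he _).trans ?_)
  refine Eq.trans ?_ (p.map_mul i _ _).symm
  exact congrArg₂ (triMul 𝕜 i) (he x).symm (he y).symm

/-- A homomorphism from `L` lifts to a homomorphism from a cover of `L` to any central extension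
of the target. -/
theorem IsMaximal.exists_lift [FiniteDimensional 𝕜 L] {D : DefiningPair 𝕜 L}
    (hD : D.IsMaximal) {B C : Type u} [AddCommGroup B] [Module 𝕜 B] [TriassociativeAlgebra 𝕜 B]
    [AddCommGroup C] [Module 𝕜 C] [TriassociativeAlgebra 𝕜 C]
    (f : TriHom 𝕜 L B) (g : TriHom 𝕜 C B) (hg : Function.Surjective g)
    (hc : ∀ c, g c = 0 → c ∈ (triCenter 𝕜 C).toSubmodule) :
    ∃ h : TriHom 𝕜 D.K C, ∀ k, g (h k) = f (D.proj k) := by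
  let fD := f.comp D.proj
  -- A section of the fiber product over `K`, followed by the projection to `C`, is the required
  -- lift. An element over `0` in `L` has both components central.
  obtain ⟨r, hr⟩ := hD.exists_section (fD.pullbackFst g)
    (fun k => by
      obtain ⟨c, hc⟩ := hg (fD k)
      exact ⟨⟨(k, c), hc.symm⟩, rfl⟩)
    (fun q hq i x => by
      have h1 : q.1.1 ∈ (triCenter 𝕜 D.K).toSubmodule := D.le_center (D.proj_eq_zero_iff.1 hq)
      have h2 : q.1.2 ∈ (triCenter 𝕜 C).toSubmodule := by
        refine hc _ (Eq.trans (Eq.symm q.2) ?_)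
        exact (congrArg f hq).trans (map_zero f.toLinearMap)
      exact ⟨Subtype.ext (Prod.ext (h1 i _).1 (h2 i _).1),
        Subtype.ext (Prod.ext (h1 i _).2 (h2 i _).2)⟩)
  refine ⟨(fD.pullbackSnd g).comp r, fun k => ?_⟩
  exact (Eq.symm (r k).2).trans (congrArg fD (hr k))

end DefiningPair

/-! ### The map `θ`, its image, and the quotient of the cover by that image. -/

section Ganea

variable {𝕜 : Type v} {L : Type u} [Field 𝕜] [AddCommGroup L] [Module 𝕜 L]
  [TriassociativeAlgebra 𝕜 L] (Z : TriIdeal 𝕜 L) (D : DefiningPair 𝕜 L)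

/-- The span in `K` of all products of an element over `Z` with an arbitrary element. -/
def ganeaSubmodule : Submodule 𝕜 D.K :=
  Submodule.span 𝕜 {a | ∃ (i : TriOp) (k t : D.K), D.proj t ∈ Z.toSubmodule ∧
    (a = triMul 𝕜 i k t ∨ a = triMul 𝕜 i t k)}

variable {Z D}

theorem triMul_mem_ganeaSubmodule (i : TriOp) (k : D.K) {t : D.K} (ht : D.proj t ∈ Z.toSubmodule) :
    triMul 𝕜 i k t ∈ ganeaSubmodule Z D ∧ triMul 𝕜 i t k ∈ ganeaSubmodule Z D :=
  ⟨Submodule.subset_span ⟨i, k, t, ht, .inl rfl⟩, Submodule.subset_span ⟨i, k, t, ht, .inr rfl⟩⟩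

theorem ganeaSubmodule_le {S : Submodule 𝕜 D.K}
    (h : ∀ (i : TriOp) (k t : D.K), D.proj t ∈ Z.toSubmodule →
      triMul 𝕜 i k t ∈ S ∧ triMul 𝕜 i t k ∈ S) : ganeaSubmodule Z D ≤ S := by
  refine Submodule.span_le.2 ?_
  rintro _ ⟨i, k, t, ht, rfl | rfl⟩
  exacts [(h i k t ht).1, (h i k t ht).2]

theorem triMul_mem_multiplier (hZ : Z.toSubmodule ≤ (triCenter 𝕜 L).toSubmodule)
    (i : TriOp) (k t : D.K) (ht : D.proj t ∈ Z.toSubmodule) :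
    triMul 𝕜 i k t ∈ D.M.toSubmodule ∧ triMul 𝕜 i t k ∈ D.M.toSubmodule := by
  rw [← D.proj_eq_zero_iff, ← D.proj_eq_zero_iff, D.proj.map_mul, D.proj.map_mul]
  exact ⟨(hZ ht i _).2, (hZ ht i _).1⟩

theorem ganeaSubmodule_le_multiplier (hZ : Z.toSubmodule ≤ (triCenter 𝕜 L).toSubmodule) :
    ganeaSubmodule Z D ≤ D.M.toSubmodule :=
  ganeaSubmodule_le (triMul_mem_multiplier hZ)

/-- This lets `θ` descend from `L` to `L/L'`. Replace `k` by an element of `K'` with the same image;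
products with `t` lie in the central ideal `M`, so rebracketing kills the product. -/
theorem triMul_derived_eq_zero_of_proj_mem (hZ : Z.toSubmodule ≤ (triCenter 𝕜 L).toSubmodule)
    {t : D.K} (ht : D.proj t ∈ Z.toSubmodule) (i : TriOp) {k : D.K}
    (hk : D.proj k ∈ (triDerived 𝕜 L).toSubmodule) :
    triMul 𝕜 i k t = 0 ∧ triMul 𝕜 i t k = 0 := by
  obtain ⟨a, ha, hak⟩ := D.proj.exists_mem_derived_of_surjective D.proj_surjective hk
  have h0 : t - t ∈ (triCenter 𝕜 D.K).toSubmodule := D.sub_mem_center rfl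
  have hka := D.sub_mem_center hak.symm
  rw [triMul_eq_of_sub_mem_center i hka h0, triMul_eq_of_sub_mem_center i h0 hka]
  exact triMul_derived_eq_zero
    (fun i x => (triMul_mem_multiplier hZ i x t ht).imp (D.le_center ·) (D.le_center ·)) i ha

/-- Define `θ` by a linear section of `K → L`. Any other lifts differ from the chosen ones by
elements of `M`, which is central, so the formula holds for all lifts. -/
theorem exists_isGaneaMap (hZ : Z.toSubmodule ≤ (triCenter 𝕜 L).toSubmodule) :
    ∃ θ : GaneaTensor Z →ₗ[𝕜] D.multiplier, IsGaneaMap Z D θ := by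
  obtain ⟨s, hs⟩ := D.proj.exists_linear_section D.proj_surjective
  have hsZ (z : Z.toSubmodule) : D.proj (s z) ∈ Z.toSubmodule := by rw [hs]; exact z.2
  let b (i : TriOp) : L →ₗ[𝕜] Z.toSubmodule →ₗ[𝕜] D.multiplier :=
    LinearMap.mk₂ 𝕜 (fun x z => ⟨triMul 𝕜 i (s x) (s z),
        (triMul_mem_multiplier hZ i (s x) (s z) (hsZ z)).1⟩)
      (fun _ _ _ => Subtype.ext (by simp [triMul])) (fun _ _ _ => Subtype.ext (by simp [triMul]))
      (fun _ _ _ => Subtype.ext (by simp [triMul])) (fun _ _ _ => Subtype.ext (by simp [triMul]))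
  let c (i : TriOp) : L →ₗ[𝕜] Z.toSubmodule →ₗ[𝕜] D.multiplier :=
    LinearMap.mk₂ 𝕜 (fun x z => ⟨triMul 𝕜 i (s z) (s x),
        (triMul_mem_multiplier hZ i (s x) (s z) (hsZ z)).2⟩)
      (fun _ _ _ => Subtype.ext (by simp [triMul])) (fun _ _ _ => Subtype.ext (by simp [triMul]))
      (fun _ _ _ => Subtype.ext (by simp [triMul])) (fun _ _ _ => Subtype.ext (by simp [triMul]))
  have hzero (i : TriOp) (x : L) (hx : x ∈ (triDerived 𝕜 L).toSubmodule) (z : Z.toSubmodule) :=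
    triMul_derived_eq_zero_of_proj_mem hZ (hsZ z) i (k := s x) (by rw [hs]; exact hx)
  let b' (i : TriOp) := TensorProduct.lift ((triDerived 𝕜 L).toSubmodule.liftQ (b i)
    (fun x hx => LinearMap.ext fun z => Subtype.ext (hzero i x hx z).1))
  let c' (i : TriOp) := TensorProduct.lift ((triDerived 𝕜 L).toSubmodule.liftQ (c i)
    (fun x hx => LinearMap.ext fun z => Subtype.ext (hzero i x hx z).2)).flip
  let m (i : TriOp) : GaneaTensor Z →ₗ[𝕜] D.multiplier :=
    (b' i).coprod (c' i) ∘ₗ LinearMap.proj i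
  have hb (i : TriOp) (k t : D.K) (ht : D.proj t ∈ Z.toSubmodule) :
      (b' i ((triDerived 𝕜 L).toSubmodule.mkQ (D.proj k) ⊗ₜ ⟨D.proj t, ht⟩) : D.K)
        = triMul 𝕜 i k t :=
    triMul_eq_of_sub_mem_center i (D.sub_mem_center (hs _)) (D.sub_mem_center (hs _))
  have hc (i : TriOp) (k t : D.K) (ht : D.proj t ∈ Z.toSubmodule) :
      (c' i (⟨D.proj t, ht⟩ ⊗ₜ (triDerived 𝕜 L).toSubmodule.mkQ (D.proj k)) : D.K)
        = triMul 𝕜 i t k :=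
    triMul_eq_of_sub_mem_center i (D.sub_mem_center (hs _)) (D.sub_mem_center (hs _))
  refine ⟨m vdash + m dashv + m perp, fun i k t ht => ?_⟩
  rw [← hb i k t ht, ← hc i k t ht]
  cases i <;> simp [m]

theorem IsGaneaMap.mem_range_iff
    {θ : GaneaTensor Z →ₗ[𝕜] D.multiplier} (hθ : IsGaneaMap Z D θ) (m : D.multiplier) :
    m ∈ Set.range θ ↔ (m : D.K) ∈ ganeaSubmodule Z D := by
  constructor
  · rintro ⟨x, rfl⟩
    suffices h : LinearMap.range θ ≤ (ganeaSubmodule Z D).comap D.multiplier.subtype from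
      h ⟨x, rfl⟩
    rw [LinearMap.range_le_iff_comap, eq_top_iff]
    rintro x -
    have hx : ∀ i, Pi.single i (x i) ∈
        ((ganeaSubmodule Z D).comap D.multiplier.subtype).comap θ := by
      intro i
      generalize x i = y
      obtain ⟨y₁, y₂⟩ := y
      have hsplit : (Pi.single i (y₁, y₂) : GaneaTensor Z)
          = Pi.single i (y₁, 0) + Pi.single i (0, y₂) := by
        rw [← Pi.single_add]; simp
      rw [hsplit]
      clear hsplit
      refine Submodule.add_mem _ ?_ ?_
      · induction y₁ with
        | zero => rw [Prod.mk_zero_zero, Pi.single_zero]; exact Submodule.zero_mem _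
        | tmul a z =>
          obtain ⟨a, rfl⟩ := Submodule.mkQ_surjective _ a
          obtain ⟨k, rfl⟩ := D.proj_surjective a
          obtain ⟨z, hz⟩ := z
          obtain ⟨t, rfl⟩ := D.proj_surjective z
          change (θ _ : D.K) ∈ ganeaSubmodule Z D
          rw [(hθ i k t hz).1]
          exact (triMul_mem_ganeaSubmodule i k hz).1
        | add a b ha hb =>
          have h : (Pi.single i (a + b, 0) : GaneaTensor Z)
              = Pi.single i (a, 0) + Pi.single i (b, 0) := by
            rw [← Pi.single_add]; simp
          rw [h]
          exact Submodule.add_mem _ ha hb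
      · induction y₂ with
        | zero => rw [Prod.mk_zero_zero, Pi.single_zero]; exact Submodule.zero_mem _
        | tmul z a =>
          obtain ⟨a, rfl⟩ := Submodule.mkQ_surjective _ a
          obtain ⟨k, rfl⟩ := D.proj_surjective a
          obtain ⟨z, hz⟩ := z
          obtain ⟨t, rfl⟩ := D.proj_surjective z
          change (θ _ : D.K) ∈ ganeaSubmodule Z D
          rw [(hθ i k t hz).2]
          exact (triMul_mem_ganeaSubmodule i k hz).2
        | add a b ha hb =>
          have h : (Pi.single i (0, a + b) : GaneaTensor Z)
              = Pi.single i (0, a) + Pi.single i (0, b) := by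
            rw [← Pi.single_add]; simp
          rw [h]
          exact Submodule.add_mem _ ha hb
    have hsum : x = Pi.single vdash (x vdash) + Pi.single dashv (x dashv)
        + Pi.single perp (x perp) := by
      ext1 i
      cases i <;> simp
    rw [hsum]
    exact Submodule.add_mem _ (Submodule.add_mem _ (hx _) (hx _)) (hx _)
  · intro hm
    have h : ganeaSubmodule Z D ≤ (LinearMap.range θ).map D.multiplier.subtype :=
      ganeaSubmodule_le fun i k t ht =>
        ⟨⟨_, ⟨_, rfl⟩, (hθ i k t ht).1⟩, ⟨_, ⟨_, rfl⟩, (hθ i k t ht).2⟩⟩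
    obtain ⟨m', hm', he⟩ := h hm
    rwa [← Subtype.ext he]

/-- The quotient of `K` by the products with elements over `Z` is a central extension of `L / Z`. -/
theorem exists_quotient_ganeaSubmodule (hZ : Z.toSubmodule ≤ (triCenter 𝕜 L).toSubmodule) :
    ∃ (C : Type u) (_ : AddCommGroup C) (_ : Module 𝕜 C) (_ : TriassociativeAlgebra 𝕜 C)
      (q : TriHom 𝕜 D.K C) (l : TriHom 𝕜 C L),
      (∀ k, l (q k) = D.proj k) ∧ Function.Surjective q ∧
      (∀ k, q k = 0 ↔ k ∈ ganeaSubmodule Z D) ∧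
      ∀ c, l c ∈ Z.toSubmodule → c ∈ (triCenter 𝕜 C).toSubmodule := by
  let J : TriIdeal 𝕜 D.K := TriIdeal.ofLECenter (ganeaSubmodule Z D)
    ((ganeaSubmodule_le_multiplier hZ).trans D.le_center)
  have hJ (k : D.K) : J.mkHom k = 0 ↔ k ∈ ganeaSubmodule Z D := Submodule.Quotient.mk_eq_zero _
  have hsurj : Function.Surjective J.mkHom := Submodule.mkQ_surjective _
  refine ⟨D.K ⧸ J.toSubmodule, inferInstance, inferInstance, inferInstance, J.mkHom,
    J.lift D.proj fun k hk => D.proj_eq_zero_iff.2 (ganeaSubmodule_le_multiplier hZ hk),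
    fun _ => rfl, hsurj, hJ, fun c hc i x => ?_⟩
  obtain ⟨t, rfl⟩ := hsurj c
  obtain ⟨k, rfl⟩ := hsurj x
  have ht : D.proj t ∈ Z.toSubmodule := hc
  rw [← J.mkHom.map_mul, ← J.mkHom.map_mul, hJ, hJ]
  exact (triMul_mem_ganeaSubmodule i k ht).symm

end Ganea

/-! ### Construction and exactness of the sequence. -/

theorem mainTheorem4 {𝕜 : Type v} {L : Type u} [Field 𝕜] [AddCommGroup L] [Module 𝕜 L]
    [TriassociativeAlgebra 𝕜 L] [FiniteDimensional 𝕜 L]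
    (Z : TriIdeal 𝕜 L) (hZ : Z.toSubmodule ≤ (triCenter 𝕜 L).toSubmodule) :
    (∃ D : DefiningPair 𝕜 L, D.IsMaximal) ∧
    (∃ D₂ : DefiningPair 𝕜 (L ⧸ Z.toSubmodule), D₂.IsMaximal) ∧
    ∀ (D : DefiningPair 𝕜 L) (D₂ : DefiningPair 𝕜 (L ⧸ Z.toSubmodule)),
      D.IsMaximal → D₂.IsMaximal →
      (∃ h : TriHom 𝕜 D.K D₂.K, ∀ k : D.K, D₂.proj (h k) = Z.mkHom (D.proj k)) ∧
      ∃ (θ : GaneaTensor Z →ₗ[𝕜] D.multiplier)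
        (β : D.multiplier →ₗ[𝕜] D₂.multiplier)
        (γ : D₂.multiplier →ₗ[𝕜] ↥((triDerived 𝕜 L).toSubmodule ⊓ Z.toSubmodule)),
        IsGaneaMap Z D θ ∧
        (∀ (P : Type (max u v)) [AddCommGroup P] [Module 𝕜 P] [TriassociativeAlgebra 𝕜 P]
          (ψ : TriHom 𝕜 P D.K) (φ : TriHom 𝕜 P D₂.K), AreLifts Z D D₂ ψ φ →
          ∀ p ∈ (triDerived 𝕜 P).toSubmodule,
            (∀ hp : ψ p ∈ D.multiplier, (β ⟨ψ p, hp⟩ : D₂.K) = φ p) ∧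
            (∀ hp : φ p ∈ D₂.multiplier, (γ ⟨φ p, hp⟩ : L) = D.proj (ψ p))) ∧
        Function.Exact θ β ∧ Function.Exact β γ ∧ Function.Surjective γ := by
  refine ⟨DefiningPair.exists_isMaximal 𝕜 L, DefiningPair.exists_isMaximal 𝕜 _,
    fun D D₂ hD hD₂ => ?_⟩
  have hZmk (x : L) : Z.mkHom x = 0 ↔ x ∈ Z.toSubmodule := Submodule.Quotient.mk_eq_zero _
  have hZsurj : Function.Surjective Z.mkHom := Submodule.mkQ_surjective _
  obtain ⟨h, hh⟩ := hD.exists_lift Z.mkHom D₂.proj D₂.proj_surjective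
    fun c hc => D₂.le_center (D₂.proj_eq_zero_iff.1 hc)
  refine ⟨⟨h, hh⟩, ?_⟩
  obtain ⟨θ, hθ⟩ := exists_isGaneaMap (D := D) hZ
  obtain ⟨C, _, _, _, q, l, hlq, hq, hq0, hlc⟩ := exists_quotient_ganeaSubmodule (D := D) hZ
  -- The kernel of `K/J → L/Z` is the preimage of `Z`, which is central in `K/J`, so the identity of
  -- `L/Z` lifts to `K̄ → K/J`.
  obtain ⟨g, hg⟩ := hD₂.exists_lift (TriHom.id 𝕜 (L ⧸ Z.toSubmodule)) (Z.mkHom.comp l)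
    (fun x => by
      obtain ⟨x, rfl⟩ := hZsurj x
      obtain ⟨k, rfl⟩ := D.proj_surjective x
      exact ⟨q k, congrArg Z.mkHom (hlq k)⟩)
    (fun c hc => hlc c ((hZmk _).1 hc))
  have hg (k : D₂.K) : Z.mkHom (l (g k)) = D₂.proj k := hg k
  -- `g ∘ h` and `q` agree on the derived ideal
  have hgh {k : D.K} (hk : k ∈ (triDerived 𝕜 D.K).toSubmodule) : g (h k) = q k := by
    refine (g.comp h).eqOn_derived q (fun x => hlc _ ?_) hk
    rw [← hZmk, map_sub, map_sub, sub_eq_zero, hlq]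
    exact (hg _).trans (hh x)
  have hhJ (k : D.K) (hk : k ∈ (triDerived 𝕜 D.K).toSubmodule) :
      h k = 0 ↔ k ∈ ganeaSubmodule Z D := by
    constructor
    · intro h0
      rw [← hq0, ← hgh hk, h0, map_zero]
    · suffices hle : ganeaSubmodule Z D ≤ LinearMap.ker h.toLinearMap from fun hk => hle hk
      refine ganeaSubmodule_le fun i k t ht => ?_
      -- Elements over `Z` are sent into `M(L/Z)`, hence into the center, so `h` kills their
      -- products.
      have hc : h t ∈ (triCenter 𝕜 D₂.K).toSubmodule := by
        refine D₂.le_center (D₂.proj_eq_zero_iff.1 ?_)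
        rw [hh]
        exact (hZmk _).2 ht
      exact ⟨(h.map_mul i k t).trans (hc i _).2, (h.map_mul i t k).trans (hc i _).1⟩
  have hβ (m : D.multiplier) : h m ∈ D₂.multiplier := by
    rw [← D₂.proj_eq_zero_iff, hh, D.proj_eq_zero_iff.2 m.2, map_zero]
  let β : D.multiplier →ₗ[𝕜] D₂.multiplier :=
    (h.toLinearMap ∘ₗ D.multiplier.subtype).codRestrict D₂.multiplier hβ
  have hγ (m : D₂.multiplier) : l (g m) ∈ (triDerived 𝕜 L).toSubmodule ⊓ Z.toSubmodule := by
    refine ⟨l.map_mem_derived (g.map_mem_derived (D₂.le_derived m.2)), ?_⟩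
    rw [SetLike.mem_coe, ← hZmk, hg]
    exact D₂.proj_eq_zero_iff.2 m.2
  let γ : D₂.multiplier →ₗ[𝕜] ↥((triDerived 𝕜 L).toSubmodule ⊓ Z.toSubmodule) :=
    ((l.toLinearMap ∘ₗ g.toLinearMap) ∘ₗ D₂.multiplier.subtype).codRestrict _ hγ
  have hγh {k : D.K} (hk : k ∈ (triDerived 𝕜 D.K).toSubmodule) : l (g (h k)) = D.proj k := by
    rw [hgh hk, hlq]
  refine ⟨θ, β, γ, hθ, fun P _ _ _ ψ φ hψφ p hp => ?_, fun m => ?_, fun m => ?_, fun z => ?_⟩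
  -- Both `h ∘ ψ` and `φ` lift the same map to `L/Z`, so they differ by central elements and
  -- coincide on `P'`.
  · have hφ : h (ψ p) = φ p := (h.comp ψ).eqOn_derived φ
      (fun x => D₂.sub_mem_center ((hh (ψ x)).trans (hψφ x).symm)) hp
    refine ⟨fun _ => hφ, fun _ => ?_⟩
    change l (g (φ p)) = _
    rw [← hφ, hγh (ψ.map_mem_derived hp)]
  · rw [hθ.mem_range_iff, ← hhJ m (D.le_derived m.2)]
    exact Subtype.ext_iff
  · constructor
    · intro hm
      -- Since `h` is onto modulo `M(L/Z)`, `m` has a preimage `k` in `K'`. There `γ` reads off the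
      -- image of `k` in `L`, so its vanishing puts `k` in `M(L)`.
      obtain ⟨k, hk, hkm⟩ := h.exists_mem_derived (fun y => by
        obtain ⟨x, hx⟩ := hZsurj (D₂.proj y)
        obtain ⟨k, rfl⟩ := D.proj_surjective x
        exact ⟨k, D₂.sub_mem_center (hx.symm.trans (hh k).symm)⟩) (D₂.le_derived m.2)
      have h0 : l (g m) = 0 := congrArg Subtype.val hm
      rw [← hkm, hγh hk] at h0
      exact ⟨⟨k, D.proj_eq_zero_iff.1 h0⟩, Subtype.ext hkm⟩
    · rintro ⟨k, rfl⟩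
      exact Subtype.ext ((hγh (D.le_derived k.2)).trans (D.proj_eq_zero_iff.2 k.2))
  · obtain ⟨z, hz, hzZ⟩ := z
    -- Lifting `z` into `K'`, not merely into `K`, is what makes `γ (h k) = z` available.
    obtain ⟨k, hk, rfl⟩ := D.proj.exists_mem_derived_of_surjective D.proj_surjective hz
    refine ⟨⟨h k, ?_⟩, Subtype.ext (hγh hk)⟩
    rw [← D₂.proj_eq_zero_iff, hh]
    exact (hZmk _).2 hzZ
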